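/- All graphs are finite, simple and undirected. Let $G=(V,E)$ be a graph with $m(G)=|E|$ edges, let $\alpha(G)$ be the maximum size of an independent set and $\mu(G)$ the maximum size of a matching of $G$. The graph $G$ is called a König–Egerváry graph if $\alpha(G)+\mu(G)=|V|$. For $A\subseteq V$ let $N(A)$ be the set of all vertices that have a neighbor in $A$. An independent set $A$ is critical if $|A|-|N(A)|=\max\{|B|-|N(B)| : B\subseteq V\}$. Let $\mathrm{core}(G)$ be the intersection of all maximum independent sets of $G$, let $\ker(G)$ be the intersection of all critical independent sets of $G$, and put $\xi(G)=|\mathrm{core}(G)|$ and $\varepsilon(G)=|\ker(G)|$. Let $\varrho_e(G)$ be the number of edges $e\in E$ such that $G-e$ (the graph $G$ with the edge $e$ deleted and all vertices kept) is a König–Egerváry graph. If $G$ is a König–Egerváry graph, then $$\varrho_e(G)=m(G)-\xi(G)+\varepsilon(G)$$ if and only if there is exactly one perfect matching between $\mathrm{core}(G)-\ker(G)$ and $N(\mathrm{core}(G))-N(\ker(G))$, that is, exactly one set $M\subseteq E$ of pairwise disjoint edges, each joining a vertex of $\mathrm{core}(G)-\ker(G)$ to a vertex of $N(\mathrm{core}(G))-N(\ker(G))$,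 which together cover all vertices of these two sets. (If both sets are empty, $M=\emptyset$ is the unique perfect matching.) -/

import Mathlib

namespace KonigEgervary

variable {V : Type*} (G : SimpleGraph V)

/-- The neighborhood `N(A) = {v : N(v) ∩ A ≠ ∅}` of a set of vertices. -/
def nbhd (A : Set V) : Set V := {v | (G.neighborSet v ∩ A).Nonempty}

/-- The set `(A, B)` of the edges `ab` of `G` with `a ∈ A` and `b ∈ B`. -/
def edgesBetween (A B : Set V) : Set (Sym2 V) :=
  {e | e ∈ G.edgeSet ∧ ∃ a ∈ A, ∃ b ∈ B, e = s(a, b)}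

/-- The matching number `μ(G)`: the largest number of edges of a matching. A matching is given
as a subgraph in which each vertex has exactly one neighbor, so it is determined by its edges. -/
noncomputable def matchingNum : ℕ :=
  sSup {k : ℕ | ∃ M : G.Subgraph, M.IsMatching ∧ M.edgeSet.ncard = k}

/-- `core(G)`: the intersection of all maximum independent sets. -/
def core [Fintype V] : Set V := {v | ∀ S : Finset V, G.IsMaximumIndepSet S → v ∈ S}

/-- The difference `d(A) = |A| - |N(A)|` of a set of vertices. -/
noncomputable def diff (A : Set V) : ℤ := (A.ncard : ℤ) - ((nbhd G A).ncard : ℤ)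

/-- The critical difference `d(G) = max {d(A) : A ⊆ V}`. -/
noncomputable def critDiff : ℤ := sSup (Set.range (diff G))

/-- Critical independent sets: independent sets `A` with `d(A) = d(G)`. -/
def IsCriticalIndep (A : Set V) : Prop := G.IsIndepSet A ∧ diff G A = critDiff G

/-- `ker(G)`: the intersection of all critical independent sets. -/
def ker : Set V := {v | ∀ A : Set V, IsCriticalIndep G A → v ∈ A}

/-- `ξ(G) = |core(G)|`. -/
noncomputable def xi [Fintype V] : ℕ := (core G).ncard

/-- `ε(G) = |ker(G)|`. -/
noncomputable def eps : ℕ := (ker G).ncard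

/-- König–Egerváry graphs: `α(G) + μ(G) = |V|`. -/
def IsKE [Fintype V] : Prop := G.indepNum + matchingNum G = Fintype.card V

/-- `ϱ_e(G)`: the number of edges `e` such that `G - e` is a König–Egerváry graph. -/
noncomputable def rhoE [Fintype V] : ℕ :=
  {e | e ∈ G.edgeSet ∧ IsKE (G.deleteEdges {e})}.ncard

/-- `M` is a perfect matching between `A` and `B`: a matching with all of its edges in `(A, B)`
that saturates exactly the vertices of `A ∪ B`. -/
def IsPerfectMatchingBetween (A B : Set V) (M : G.Subgraph) : Prop :=
  M.IsMatching ∧ M.edgeSet ⊆ edgesBetween G A B ∧ M.verts = A ∪ B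

/-- On a finite graph the supremum in `matchingNum` is attained. -/
theorem isGreatest_matchingNum [Finite V] :
    IsGreatest {k : ℕ | ∃ M : G.Subgraph, M.IsMatching ∧ M.edgeSet.ncard = k}
      (matchingNum G) := by
  have hb : BddAbove {k : ℕ | ∃ M : G.Subgraph, M.IsMatching ∧ M.edgeSet.ncard = k} := by
    refine ⟨Nat.card (Sym2 V), ?_⟩
    rintro k ⟨M, -, rfl⟩
    exact Set.ncard_le_card _
  have hne : {k : ℕ | ∃ M : G.Subgraph, M.IsMatching ∧ M.edgeSet.ncard = k}.Nonempty :=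
    ⟨_, ⊥, fun v hv => hv.elim, rfl⟩
  exact ⟨Nat.sSup_mem hne hb, fun k hk => le_csSup hb hk⟩

/-- On a finite graph the supremum in `critDiff` is attained. -/
theorem isGreatest_critDiff [Finite V] : IsGreatest (Set.range (diff G)) (critDiff G) :=
  ⟨(Set.range_nonempty _).csSup_mem (Set.finite_range _),
    fun _ h => le_csSup (Set.finite_range _).bddAbove h⟩

end KonigEgervary

namespace KonigEgervary

variable {V : Type*}

/-! ### Maximum independent sets and matchings given by functions -/

/-! Fix a maximum independent set `S` and, by the König–Egerváry property, a map `f` matching `Sᶜ`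
into `S`; values of `f` on `S` play no role. Write K for the kernel and C for the core.

An edge avoided by some such matching can be deleted harmlessly: `S` and that matching remain. So a
bad edge (one whose deletion destroys the property) is forced, of the form `s(x, f x)` with `g x = f
x` for every matching `g` of `Sᶜ` into `S`. For a forced edge three cases arise. If `x ∉ N(C)`, a
Hall-tight set and a maximum independent set missing `f x` give a larger independent set after
deletion, so the edge is not bad (`SatMatch.isKE_deleteEdges_of_not_mem`). If `x ∈ N(C)`, deletion
does not increase the independence number but lowers the matching number, so the edge is bad
(`SatMatch.not_isKE_deleteEdges`). If `x ∈ N(K)`, forcing is impossible, because a tight set would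
cut K down to a smaller critical set (`SatMatch.exists_ne_of_mem_nbhd_ker`).

Hence the bad edges correspond to the forced vertices of `N(C) \ N(K)`. Since `f` maps this set
bijectively onto `C \ K`, it has `ξ - ε` elements, and the formula says that all of them are forced.
This is uniqueness of the perfect matching, as any other one could be spliced into `f`. -/

/-- `S` is an independent set of maximum size. -/
def IsMaxIndep (G : SimpleGraph V) (S : Set V) : Prop :=
  G.IsIndepSet S ∧ S.ncard = G.indepNum

/-- `f` matches the complement of `S` into `S` along edges of `G`. -/
structure SatMatch (G : SimpleGraph V) (S : Set V) (f : V → V) : Prop where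
  mapsTo : ∀ x ∉ S, f x ∈ S
  adj : ∀ x ∉ S, G.Adj x (f x)
  inj : ∀ x ∉ S, ∀ y ∉ S, f x = f y → x = y

theorem mem_nbhd {G : SimpleGraph V} {A : Set V} {v : V} :
    v ∈ nbhd G A ↔ ∃ a ∈ A, G.Adj v a := by
  simp only [nbhd, Set.Nonempty, Set.mem_ofPred_eq, Set.mem_inter_iff, SimpleGraph.mem_neighborSet]
  exact ⟨fun ⟨x, h, k⟩ => ⟨x, k, h⟩, fun ⟨x, h, k⟩ => ⟨x, k, h⟩⟩

theorem nbhd_mono {G : SimpleGraph V} {A B : Set V} (h : A ⊆ B) : nbhd G A ⊆ nbhd G B := by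
  intro v hv
  obtain ⟨a, ha, hva⟩ := mem_nbhd.1 hv
  exact mem_nbhd.2 ⟨a, h ha, hva⟩

theorem not_adj_of_mem {G : SimpleGraph V} {S : Set V} (hS : G.IsIndepSet S) {a b : V}
    (ha : a ∈ S) (hb : b ∈ S) : ¬ G.Adj a b :=
  fun h => hS ha hb h.ne h

theorem isIndepSet_of {G : SimpleGraph V} {S : Set V}
    (h : ∀ a ∈ S, ∀ b ∈ S, ¬ G.Adj a b) : G.IsIndepSet S :=
  fun _ ha _ hb _ => h _ ha _ hb

theorem ncard_le_indepNum [Finite V] {G : SimpleGraph V} {S : Set V} (hS : G.IsIndepSet S) :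
    S.ncard ≤ G.indepNum := by
  have hf := S.toFinite
  rw [Set.ncard_eq_toFinset_card S hf]
  exact SimpleGraph.IsIndepSet.card_le_indepNum (by simpa using hS)

theorem isMaximumIndepSet_iff_isMaxIndep [Finite V] {G : SimpleGraph V} {S : Finset V} :
    G.IsMaximumIndepSet S ↔ IsMaxIndep G (S : Set V) := by
  constructor
  · intro h
    exact ⟨h.isIndepSet, by
      rw [Set.ncard_coe_finset]; exact SimpleGraph.maximumIndepSet_card_eq_indepNum S h⟩
  · rintro ⟨h, hc⟩
    rw [Set.ncard_coe_finset] at hc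
    exact ⟨h, fun t ht => hc ▸ ht.card_le_indepNum⟩

theorem exists_isMaxIndep [Finite V] (G : SimpleGraph V) : ∃ S, IsMaxIndep G S := by
  obtain ⟨S, hS⟩ := G.maximumIndepSet_exists
  exact ⟨S, isMaximumIndepSet_iff_isMaxIndep.1 hS⟩

theorem mem_core [Fintype V] {G : SimpleGraph V} {v : V} :
    v ∈ core G ↔ ∀ S, IsMaxIndep G S → v ∈ S := by
  constructor
  · intro h S hS
    have := h S.toFinite.toFinset (isMaximumIndepSet_iff_isMaxIndep.2 (by simpa using hS))
    simpa using this
  · intro h S hS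
    exact h S (isMaximumIndepSet_iff_isMaxIndep.1 hS)

theorem isMaxIndep_of_le [Finite V] {G : SimpleGraph V} {S : Set V} (hS : G.IsIndepSet S)
    (h : G.indepNum ≤ S.ncard) : IsMaxIndep G S :=
  ⟨hS, le_antisymm (ncard_le_indepNum hS) h⟩

/-! ### Matchings counted against independent sets -/

theorem edge_eq_of_mem {G : SimpleGraph V} {M : G.Subgraph} (hM : M.IsMatching)
    {e e' : Sym2 V} (he : e ∈ M.edgeSet) (he' : e' ∈ M.edgeSet) {v : V} (hv : v ∈ e)
    (hv' : v ∈ e') : e = e' := by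
  obtain ⟨w, rfl⟩ := hv
  obtain ⟨w', rfl⟩ := hv'
  rw [SimpleGraph.Subgraph.mem_edgeSet] at he he'
  rw [hM.eq_of_adj_left he he']

theorem exists_mem_not_mem {G : SimpleGraph V} {S : Set V} (hS : G.IsIndepSet S)
    {e : Sym2 V} (he : e ∈ G.edgeSet) : ∃ v, v ∈ e ∧ v ∉ S := by
  induction e with
  | _ a b =>
    rw [SimpleGraph.mem_edgeSet] at he
    by_cases ha : a ∈ S
    · exact ⟨b, by simp, fun hb => not_adj_of_mem hS ha hb he⟩
    · exact ⟨a, by simp, ha⟩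

/-- A matching has at most as many edges as the complement of an independent set has vertices,
and in case of equality it matches this complement into the independent set. -/
theorem matching_ncard_le [Finite V] {G : SimpleGraph V} {M : G.Subgraph} (hM : M.IsMatching)
    {S : Set V} (hS : G.IsIndepSet S) :
    M.edgeSet.ncard ≤ Sᶜ.ncard ∧
      (Sᶜ.ncard ≤ M.edgeSet.ncard → ∃ f, SatMatch G S f) := by
  classical
  choose h hmem hns using fun e : M.edgeSet => exists_mem_not_mem hS (M.edgeSet_subset e.2)
  have hinj : ∀ e e' : M.edgeSet, h e = h e' → e = e' := fun e e' hee =>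
    Subtype.ext (edge_eq_of_mem hM e.2 e'.2 (hmem e) (hee ▸ hmem e'))
  have hcard : M.edgeSet.ncard = (Set.range h).ncard := by
    rw [← Set.image_univ, Set.ncard_image_of_injective _ (fun e e' => hinj e e'), Set.ncard_univ]
    rfl
  have hsub : Set.range h ⊆ Sᶜ := by rintro _ ⟨e, rfl⟩; exact hns e
  refine ⟨hcard ▸ Set.ncard_le_ncard hsub, fun hle => ?_⟩
  have heq : Set.range h = Sᶜ := Set.eq_of_subset_of_ncard_le hsub (hcard ▸ hle)
  have hex : ∀ x, ∃ y, x ∉ S → M.Adj x y ∧ ∃ e : M.edgeSet, e.1 = s(x, y) ∧ h e = x := by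
    intro x
    by_cases hx : x ∈ S
    · exact ⟨x, fun h => absurd hx h⟩
    · obtain ⟨e, he⟩ : x ∈ Set.range h := heq ▸ hx
      obtain ⟨y, hy⟩ := he ▸ hmem e
      refine ⟨y, fun _ => ⟨?_, e, hy, he⟩⟩
      rw [← SimpleGraph.Subgraph.mem_edgeSet, ← hy]
      exact e.2
  choose f hf using hex
  have key : ∀ x ∉ S, ∀ z ∉ S, f x ∈ s(z, f z) → x = z := by
    intro x hx z hz hm
    obtain ⟨hadj, e, he, hex⟩ := hf x hx
    obtain ⟨hadj', e', he', hez⟩ := hf z hz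
    have : e = e' := Subtype.ext (edge_eq_of_mem hM e.2 e'.2 (v := f x) (by simp [he]) (he' ▸ hm))
    rw [← hex, ← hez, this]
  refine ⟨f, ⟨fun x hx => ?_, fun x hx => (hf x hx).1.adj_sub, fun x hx y hy hxy => ?_⟩⟩
  · by_contra hfx
    have := key x hx (f x) hfx (by simp)
    exact (hf x hx).1.adj_sub.ne this
  · exact key x hx y hy (by simp [hxy])

/-- The subgraph with the edges `s(x, f x)` for `x ∈ X`. -/
def pairing (G : SimpleGraph V) (X : Set V) (f : V → V) (h : ∀ x ∈ X, G.Adj x (f x)) :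
    G.Subgraph where
  verts := X ∪ f '' X
  Adj u v := (u ∈ X ∧ v = f u) ∨ (v ∈ X ∧ u = f v)
  adj_sub := by
    rintro u v (⟨hu, rfl⟩ | ⟨hv, rfl⟩)
    · exact h u hu
    · exact (h v hv).symm
  edge_vert := by
    rintro u v (⟨hu, rfl⟩ | ⟨hv, rfl⟩)
    · exact Or.inl hu
    · exact Or.inr ⟨v, hv, rfl⟩
  symm := ⟨fun _ _ h => h.symm⟩

theorem pairing_isMatching {G : SimpleGraph V} {X : Set V} {f : V → V}
    (h : ∀ x ∈ X, G.Adj x (f x)) (hX : ∀ x ∈ X, f x ∉ X)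
    (hinj : ∀ x ∈ X, ∀ y ∈ X, f x = f y → x = y) : (pairing G X f h).IsMatching := by
  rintro v (hv | ⟨x, hx, rfl⟩)
  · refine ⟨f v, Or.inl ⟨hv, rfl⟩, ?_⟩
    rintro w (⟨-, hw⟩ | ⟨hw, hvw⟩)
    · exact hw
    · exact absurd (hvw ▸ hv) (hX w hw)
  · refine ⟨x, Or.inr ⟨hx, rfl⟩, ?_⟩
    rintro w (⟨hw, -⟩ | ⟨hw, hvw⟩)
    · exact absurd hw (hX x hx)
    · exact (hinj x hx w hw hvw).symm

theorem pairing_edgeSet {G : SimpleGraph V} {X : Set V} {f : V → V}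
    (h : ∀ x ∈ X, G.Adj x (f x)) :
    (pairing G X f h).edgeSet = (fun x => s(x, f x)) '' X := by
  ext e
  induction e with
  | _ a b =>
    rw [SimpleGraph.Subgraph.mem_edgeSet]
    constructor
    · rintro (⟨hu, rfl⟩ | ⟨hv, rfl⟩)
      · exact ⟨a, hu, rfl⟩
      · exact ⟨b, hv, Sym2.eq_swap⟩
    · rintro ⟨x, hx, hxe⟩
      rcases Sym2.eq_iff.1 hxe with ⟨rfl, rfl⟩ | ⟨rfl, rfl⟩
      · exact Or.inl ⟨hx, rfl⟩
      · exact Or.inr ⟨hx, rfl⟩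

theorem mk_injOn {X : Set V} {f : V → V} (hX : ∀ x ∈ X, f x ∉ X) :
    Set.InjOn (fun x => s(x, f x)) X := by
  intro x hx y hy hxy
  rcases Sym2.eq_iff.1 hxy with ⟨h, -⟩ | ⟨h, -⟩
  · exact h
  · exact absurd (h ▸ hx) (hX y hy)

theorem ncard_le_matchingNum [Finite V] {G : SimpleGraph V} {X : Set V} {f : V → V}
    (h : ∀ x ∈ X, G.Adj x (f x)) (hX : ∀ x ∈ X, f x ∉ X)
    (hinj : ∀ x ∈ X, ∀ y ∈ X, f x = f y → x = y) : X.ncard ≤ matchingNum G := by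
  apply (isGreatest_matchingNum G).2
  refine ⟨_, pairing_isMatching h hX hinj, ?_⟩
  rw [pairing_edgeSet, (mk_injOn hX).ncard_image]

theorem matchingNum_le [Finite V] {G : SimpleGraph V} {S : Set V} (hS : G.IsIndepSet S) :
    matchingNum G ≤ Sᶜ.ncard := by
  obtain ⟨M, hM, hc⟩ := (isGreatest_matchingNum G).1
  rw [← hc]
  exact (matching_ncard_le hM hS).1

/-- In a König–Egerváry graph, the complement of each maximum independent set is matched into
this set. -/
theorem IsKE.exists_satMatch [Fintype V] {G : SimpleGraph V} (hG : IsKE G) {S : Set V}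
    (hS : IsMaxIndep G S) : ∃ f, SatMatch G S f := by
  obtain ⟨M, hM, hc⟩ := (isGreatest_matchingNum G).1
  refine (matching_ncard_le hM hS.1).2 ?_
  have h1 := Set.ncard_add_ncard_compl S
  have h2 : G.indepNum + matchingNum G = Fintype.card V := hG
  rw [← Nat.card_eq_fintype_card] at h2
  have h3 := hS.2
  omega

/-- An independent set and a matching with together at least `|V|` elements. -/
theorem isKE_of [Fintype V] {G : SimpleGraph V} {S X : Set V} {f : V → V} (hS : G.IsIndepSet S)
    (h : ∀ x ∈ X, G.Adj x (f x)) (hX : ∀ x ∈ X, f x ∉ X)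
    (hinj : ∀ x ∈ X, ∀ y ∈ X, f x = f y → x = y) (hc : Nat.card V ≤ S.ncard + X.ncard) :
    IsKE G := by
  have h1 := ncard_le_matchingNum h hX hinj
  have h2 := ncard_le_indepNum hS
  obtain ⟨T, hT⟩ := exists_isMaxIndep G
  have h3 := matchingNum_le hT.1
  have h4 := Set.ncard_add_ncard_compl T
  have h5 := hT.2
  unfold IsKE
  rw [← Nat.card_eq_fintype_card]
  omega

theorem SatMatch.isKE [Fintype V] {G : SimpleGraph V} {S : Set V} {f : V → V}
    (hf : SatMatch G S f) (hS : G.IsIndepSet S) : IsKE G :=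
  isKE_of hS (X := Sᶜ) hf.adj (fun x hx h => h (hf.mapsTo x hx)) hf.inj
    (Set.ncard_add_ncard_compl S).ge

/-- Each maximum independent set contains an endpoint of each edge of a maximum matching and
all vertices that it misses. -/
theorem SatMatch.exists_of_not_mem [Finite V] {G : SimpleGraph V} {S S' : Set V} {f : V → V}
    (hf : SatMatch G S f) (hS : IsMaxIndep G S) (hS' : IsMaxIndep G S') {v : V}
    (hv : v ∈ S) (hv' : v ∉ S') : ∃ y ∉ S, f y = v ∧ y ∈ S' := by
  classical
  have hc : S'ᶜ.ncard ≤ Sᶜ.ncard := by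
    have h1 := Set.ncard_add_ncard_compl S
    have h2 := Set.ncard_add_ncard_compl S'
    have h3 := hS.2
    have h4 := hS'.2
    omega
  -- Moving `x` to `f x` exactly when `x ∈ S'` injects `Sᶜ` into `S'ᶜ`. The sizes agree, so `v` is
  -- hit, and since `v ∈ S` it is hit as some `f y` with `y ∈ S'`.
  have hmap : ∀ x ∈ Sᶜ, (if x ∈ S' then f x else x) ∈ S'ᶜ := by
    intro x hx
    by_cases hxS : x ∈ S'
    · rw [if_pos hxS]
      exact fun h => not_adj_of_mem hS'.1 hxS h (hf.adj x hx)
    · rwa [if_neg hxS]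
  have hinj : ∀ x y, x ∈ Sᶜ → y ∈ Sᶜ →
      (if x ∈ S' then f x else x) = (if y ∈ S' then f y else y) → x = y := by
    intro x y hx hy hxy
    split_ifs at hxy
    · exact hf.inj x hx y hy hxy
    · exact absurd (hxy ▸ hf.mapsTo x hx) hy
    · exact absurd (hxy ▸ hf.mapsTo y hy) hx
    · exact hxy
  obtain ⟨y, hy, h⟩ := Set.surj_on_of_inj_on_of_ncard_le
    (fun x _ => if x ∈ S' then f x else x) hmap hinj hc (Set.toFinite _) v hv'
  by_cases hyS : y ∈ S'
  · rw [if_pos hyS] at h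
    exact ⟨y, hy, h.symm, hyS⟩
  · rw [if_neg hyS] at h
    exact absurd (h ▸ hv) hy

/-- If each matching of the complement of `S` into `S` uses the edge `s(x, f x)`, then there is
a set `X` of vertices, tight for Hall's condition, in which only `x` is adjacent to `f x`. -/
theorem SatMatch.exists_tight [Finite V] {G : SimpleGraph V} {S : Set V} {f : V → V}
    (hf : SatMatch G S f) {x : V} (hx : x ∉ S)
    (hall : ∀ g, SatMatch G S g → g x = f x) :
    ∃ X : Set V, X ⊆ Sᶜ ∧ x ∈ X ∧ (∀ y ∈ X, ∀ c ∈ S, G.Adj y c → c ∈ f '' X) ∧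
      ∀ y ∈ X, G.Adj y (f x) → y = x := by
  classical
  have := Fintype.ofFinite V
  -- Neighbors in `S` with the single edge from `x` to `f x` removed. A transversal would be a
  -- matching avoiding that edge, so Hall's condition fails.
  let t : {y // y ∉ S} → Finset V := fun y =>
    Finset.univ.filter fun c => c ∈ S ∧ G.Adj y c ∧ (c = f x → y.1 ≠ x)
  have ht : ∀ y c, c ∈ t y ↔ c ∈ S ∧ G.Adj y c ∧ (c = f x → y.1 ≠ x) := by
    intro y c; simp [t]
  have hno : ¬ ∀ s : Finset {y // y ∉ S}, s.card ≤ (s.biUnion t).card := by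
    rw [Finset.all_card_le_biUnion_card_iff_exists_injective]
    rintro ⟨g, hg, hgt⟩
    have hsat : SatMatch G S (fun y => if h : y ∈ S then y else g ⟨y, h⟩) := by
      refine ⟨fun y hy => ?_, fun y hy => ?_, fun y hy z hz hyz => ?_⟩
      · simp only [dif_neg hy]; exact ((ht _ _).1 (hgt ⟨y, hy⟩)).1
      · simp only [dif_neg hy]; exact ((ht _ _).1 (hgt ⟨y, hy⟩)).2.1
      · simp only [dif_neg hy, dif_neg hz] at hyz
        exact congrArg Subtype.val (hg hyz)
    have := hall _ hsat
    simp only [dif_neg hx] at this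
    exact ((ht _ _).1 (hgt ⟨x, hx⟩)).2.2 this rfl
  push Not at hno
  obtain ⟨s, hs⟩ := hno
  let F : {y // y ∉ S} → V := fun y => f y
  have hF : Function.Injective F := fun y z h => Subtype.ext (hf.inj _ y.2 _ z.2 h)
  have hFc : (s.image F).card = s.card := Finset.card_image_of_injective _ hF
  have hsub : ∀ y ∈ s, y.1 ≠ x → F y ∈ s.biUnion t := by
    intro y hy hyx
    exact Finset.mem_biUnion.2 ⟨y, hy, (ht _ _).2 ⟨hf.mapsTo _ y.2, hf.adj _ y.2, fun _ => hyx⟩⟩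
  have hfx : f x ∉ s.biUnion t := by
    intro hmem
    refine absurd (Finset.card_le_card (s := s.image F) (t := s.biUnion t) ?_) (by omega)
    intro c hc
    obtain ⟨y, hy, rfl⟩ := Finset.mem_image.1 hc
    by_cases hyx : y.1 = x
    · simpa only [F, hyx] using hmem
    · exact hsub y hy hyx
  have hxs : ∃ h, (⟨x, h⟩ : {y // y ∉ S}) ∈ s := by
    by_contra hcon
    refine absurd (Finset.card_le_card (s := s.image F) (t := s.biUnion t) ?_) (by omega)
    intro c hc
    obtain ⟨y, hy, rfl⟩ := Finset.mem_image.1 hc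
    refine hsub y hy ?_
    rintro rfl
    exact hcon ⟨y.2, hy⟩
  obtain ⟨hx', hxs⟩ := hxs
  -- The violating set is deficient by exactly one: its neighbors after removal are its `f`-partners
  -- other than `f x`.
  have heq : s.image F = insert (f x) (s.biUnion t) := by
    apply Finset.eq_of_subset_of_card_le
    · intro c hc
      obtain ⟨y, hy, rfl⟩ := Finset.mem_image.1 hc
      by_cases hyx : y.1 = x
      · simp [F, hyx]
      · exact Finset.mem_insert_of_mem (hsub y hy hyx)
    · rw [Finset.card_insert_of_notMem hfx]
      omega
  refine ⟨Subtype.val '' (s : Set {y // y ∉ S}), ?_, ⟨_, hxs, rfl⟩, ?_, ?_⟩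
  · rintro _ ⟨y, -, rfl⟩
    exact y.2
  · rintro _ ⟨y, hy, rfl⟩ c hc hyc
    have hcm : c ∈ s.image F := by
      rw [heq, Finset.mem_insert]
      by_cases hcx : c = f x
      · exact Or.inl hcx
      · exact Or.inr (Finset.mem_biUnion.2 ⟨y, hy, (ht _ _).2 ⟨hc, hyc, fun h => absurd h hcx⟩⟩)
    obtain ⟨z, hz, hzc⟩ := Finset.mem_image.1 hcm
    exact ⟨z.1, ⟨z, hz, rfl⟩, hzc⟩
  · rintro _ ⟨y, hy, rfl⟩ hyc
    by_contra hyx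
    exact hfx (Finset.mem_biUnion.2 ⟨y, hy, (ht _ _).2 ⟨hf.mapsTo _ hx, hyc, fun _ => hyx⟩⟩)

/-! ### The core and the kernel of a König–Egerváry graph -/

section Core

variable {G : SimpleGraph V} {S : Set V} {f : V → V}

theorem SatMatch.mem_nbhd_of_map_mem (hf : SatMatch G S f) {A : Set V} {x : V} (hx : x ∉ S)
    (h : f x ∈ A) : x ∈ nbhd G A :=
  mem_nbhd.2 ⟨_, h, hf.adj x hx⟩

theorem ker_subset {A : Set V} (hA : IsCriticalIndep G A) : ker G ⊆ A := fun _ hv => hv A hA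

theorem nbhd_subset_compl (hS : G.IsIndepSet S) : nbhd G S ⊆ Sᶜ := by
  intro v hv
  obtain ⟨a, ha, hva⟩ := mem_nbhd.1 hv
  exact fun h => not_adj_of_mem hS h ha hva

variable [Fintype V]

theorem core_subset (hS : IsMaxIndep G S) : core G ⊆ S := fun _ hv => mem_core.1 hv S hS

theorem not_mem_of_mem_nbhd_core (hS : IsMaxIndep G S) {x : V} (hx : x ∈ nbhd G (core G)) :
    x ∉ S := by
  obtain ⟨c, hc, hxc⟩ := mem_nbhd.1 hx
  exact fun h => not_adj_of_mem hS.1 h (core_subset hS hc) hxc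

/-- A maximum independent set missing `f x` would contain `x` by the exchange lemma, which is
impossible for a neighbor of the core. -/
theorem SatMatch.map_mem_core (hf : SatMatch G S f) (hS : IsMaxIndep G S) {x : V}
    (hx : x ∈ nbhd G (core G)) : f x ∈ core G := by
  have hxS := not_mem_of_mem_nbhd_core hS hx
  rw [mem_core]
  intro S' hS'
  by_contra hcon
  obtain ⟨y, hy, hyx, hyS⟩ := hf.exists_of_not_mem hS hS' (hf.mapsTo x hxS) hcon
  rw [hf.inj y hy x hxS hyx] at hyS
  exact not_mem_of_mem_nbhd_core hS' hx hyS

/-! ### The critical difference and the structure of the kernel -/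

theorem SatMatch.ncard_diff_image (hf : SatMatch G S f) :
    ((S \ f '' Sᶜ).ncard : ℤ) = S.ncard - Sᶜ.ncard := by
  have h1 : (f '' Sᶜ).ncard = Sᶜ.ncard :=
    Set.InjOn.ncard_image (fun x hx y hy => hf.inj x hx y hy)
  have h2 : f '' Sᶜ ⊆ S := by rintro _ ⟨x, hx, rfl⟩; exact hf.mapsTo x hx
  have h3 := Set.ncard_sdiff_add_ncard_of_subset h2
  omega

/-- The difference of a set is at most the number of its vertices that `f` does not match. -/
theorem SatMatch.diff_le (hf : SatMatch G S f) (A : Set V) :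
    diff G A ≤ ((A ∩ (S \ f '' Sᶜ)).ncard : ℤ) := by
  classical
  have h1 : (A \ (S \ f '' Sᶜ)).ncard ≤ (nbhd G A).ncard := by
    -- Each matched vertex is sent to its partner, a neighbor; this is injective in both directions
    -- of the matching.
    have hex : ∀ v, ∃ w, v ∈ A \ (S \ f '' Sᶜ) →
        G.Adj v w ∧ ((v ∉ S ∧ w = f v) ∨ (w ∉ S ∧ v = f w)) := by
      intro v
      by_cases hv : v ∈ S
      · by_cases hv' : v ∈ f '' Sᶜ
        · obtain ⟨w, hw, rfl⟩ := hv'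
          exact ⟨w, fun _ => ⟨(hf.adj w hw).symm, Or.inr ⟨hw, rfl⟩⟩⟩
        · exact ⟨v, fun h => absurd ⟨hv, hv'⟩ h.2⟩
      · exact ⟨f v, fun _ => ⟨hf.adj v hv, Or.inl ⟨hv, rfl⟩⟩⟩
    choose g hg using hex
    refine Set.ncard_le_ncard_of_injOn g (fun v hv => ?_) (fun v hv w hw hvw => ?_)
    · exact mem_nbhd.2 ⟨v, hv.1, (hg v hv).1.symm⟩
    · rcases (hg v hv).2 with ⟨h1, h2⟩ | ⟨h1, h2⟩ <;> rcases (hg w hw).2 with ⟨h3, h4⟩ | ⟨h3, h4⟩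
      · exact hf.inj v h1 w h3 (h2 ▸ h4 ▸ hvw)
      · exact absurd (hvw ▸ h2 ▸ hf.mapsTo v h1) h3
      · exact absurd (hvw ▸ h4 ▸ hf.mapsTo w h3) h1
      · rw [h2, h4, hvw]
  have h2 := Set.ncard_inter_add_ncard_sdiff_eq_ncard A (S \ f '' Sᶜ)
  unfold diff
  omega

theorem SatMatch.critDiff_eq (hf : SatMatch G S f) (hS : G.IsIndepSet S) :
    critDiff G = ((S \ f '' Sᶜ).ncard : ℤ) := by
  apply le_antisymm
  · obtain ⟨A, hA⟩ := (isGreatest_critDiff G).1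
    rw [← hA]
    refine (hf.diff_le A).trans ?_
    exact_mod_cast Set.ncard_le_ncard Set.inter_subset_right
  · refine le_trans ?_ ((isGreatest_critDiff G).2 ⟨S, rfl⟩)
    rw [hf.ncard_diff_image]
    have := Set.ncard_le_ncard (nbhd_subset_compl hS)
    unfold diff
    omega

theorem SatMatch.isCriticalIndep (hf : SatMatch G S f) (hS : G.IsIndepSet S) :
    IsCriticalIndep G S := by
  refine ⟨hS, le_antisymm ((isGreatest_critDiff G).2 ⟨S, rfl⟩) ?_⟩
  rw [hf.critDiff_eq hS, hf.ncard_diff_image]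
  have := Set.ncard_le_ncard (nbhd_subset_compl hS)
  unfold diff
  omega

/-- Supermodularity of `diff`: the union cannot exceed the critical difference, so the intersection
cannot fall below it. -/
theorem IsCriticalIndep.inter {A B : Set V} (hA : IsCriticalIndep G A)
    (hB : IsCriticalIndep G B) : IsCriticalIndep G (A ∩ B) := by
  refine ⟨hA.1.mono Set.inter_subset_left,
    le_antisymm ((isGreatest_critDiff G).2 ⟨_, rfl⟩) ?_⟩
  have h1 : diff G (A ∪ B) ≤ critDiff G := (isGreatest_critDiff G).2 ⟨_, rfl⟩
  have h2 := hA.2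
  have h3 := hB.2
  have h4 := Set.ncard_union_add_ncard_inter A B
  have h5 := Set.ncard_union_add_ncard_inter (nbhd G A) (nbhd G B)
  have h6 : (nbhd G (A ∩ B)).ncard ≤ (nbhd G A ∩ nbhd G B).ncard :=
    Set.ncard_le_ncard (Set.subset_inter (nbhd_mono Set.inter_subset_left)
      (nbhd_mono Set.inter_subset_right))
  have h7 : (nbhd G (A ∪ B)).ncard ≤ (nbhd G A ∪ nbhd G B).ncard := by
    refine Set.ncard_le_ncard ?_
    intro v hv
    obtain ⟨a, ha | ha, hva⟩ := mem_nbhd.1 hv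
    · exact Or.inl (mem_nbhd.2 ⟨a, ha, hva⟩)
    · exact Or.inr (mem_nbhd.2 ⟨a, ha, hva⟩)
  unfold diff at *
  omega

theorem isCriticalIndep_ker {A : Set V} (hA : IsCriticalIndep G A) :
    IsCriticalIndep G (ker G) := by
  obtain ⟨B, hB, hmin⟩ := (Set.toFinite {A | IsCriticalIndep G A}).exists_minimalFor
    Set.ncard _ ⟨A, hA⟩
  have : ker G = B := by
    apply (ker_subset hB).antisymm
    intro v hv C hC
    have hle := hmin (hB.inter hC) (Set.ncard_le_ncard Set.inter_subset_left)
    have heq := Set.eq_of_subset_of_ncard_le Set.inter_subset_left hle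
    exact (heq.symm ▸ hv : v ∈ B ∩ C).2
  rw [this]
  exact hB

theorem IsKE.ker_subset_core (hG : IsKE G) : ker G ⊆ core G := by
  intro v hv
  rw [mem_core]
  intro S hS
  obtain ⟨f, hf⟩ := hG.exists_satMatch hS
  exact hv S (hf.isCriticalIndep hS.1)

/-- A vertex of the kernel is either unmatched or the partner of one of its neighbors. The right
side has at most `critDiff G + |N(ker G)| = |ker G|` elements, so the inclusion is an equality. -/
theorem SatMatch.ker_eq (hf : SatMatch G S f) (hS : IsMaxIndep G S) (hG : IsKE G) :
    ker G = (S \ f '' Sᶜ) ∪ f '' nbhd G (ker G) := by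
  have hK := isCriticalIndep_ker (hf.isCriticalIndep hS.1)
  have hsub : nbhd G (ker G) ⊆ Sᶜ := fun x hx =>
    not_mem_of_mem_nbhd_core hS (nbhd_mono hG.ker_subset_core hx)
  refine Set.eq_of_subset_of_ncard_le ?_ ?_
  · intro v hv
    have hvS := core_subset hS (hG.ker_subset_core hv)
    by_cases h : v ∈ f '' Sᶜ
    · obtain ⟨x, hx, rfl⟩ := h
      exact Or.inr ⟨x, hf.mem_nbhd_of_map_mem hx hv, rfl⟩
    · exact Or.inl ⟨hvS, h⟩
  · have h1 := Set.ncard_union_le (S \ f '' Sᶜ) (f '' nbhd G (ker G))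
    have h2 : (f '' nbhd G (ker G)).ncard = (nbhd G (ker G)).ncard :=
      Set.InjOn.ncard_image fun x hx y hy => hf.inj x (hsub hx) y (hsub hy)
    have h3 := hK.2
    rw [hf.critDiff_eq hS.1] at h3
    unfold diff at h3
    omega

theorem SatMatch.image_eq (hf : SatMatch G S f) (hS : IsMaxIndep G S) (hG : IsKE G) :
    f '' (nbhd G (core G) \ nbhd G (ker G)) = core G \ ker G := by
  have hker := hf.ker_eq hS hG
  ext c
  constructor
  · rintro ⟨x, ⟨hx, hx'⟩, rfl⟩
    exact ⟨hf.map_mem_core hS hx, fun h =>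
      hx' (hf.mem_nbhd_of_map_mem (not_mem_of_mem_nbhd_core hS hx) h)⟩
  · rintro ⟨hc, hc'⟩
    rw [hker] at hc'
    have : c ∈ f '' Sᶜ := by
      by_contra h
      exact hc' (Or.inl ⟨core_subset hS hc, h⟩)
    obtain ⟨x, hx, rfl⟩ := this
    exact ⟨x, ⟨hf.mem_nbhd_of_map_mem hx hc, fun h => hc' (Or.inr ⟨x, h, rfl⟩)⟩, rfl⟩

theorem SatMatch.ncard_nbhd_diff (hf : SatMatch G S f) (hS : IsMaxIndep G S) (hG : IsKE G) :
    (nbhd G (core G) \ nbhd G (ker G)).ncard = xi G - eps G ∧ eps G ≤ xi G := by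
  have hsub := hG.ker_subset_core
  have h1 : (f '' (nbhd G (core G) \ nbhd G (ker G))).ncard =
      (nbhd G (core G) \ nbhd G (ker G)).ncard :=
    Set.InjOn.ncard_image fun x hx y hy =>
      hf.inj x (not_mem_of_mem_nbhd_core hS hx.1) y (not_mem_of_mem_nbhd_core hS hy.1)
  rw [hf.image_eq hS hG] at h1
  have h2 := Set.ncard_sdiff_add_ncard_of_subset hsub
  unfold xi eps
  omega

/-- No edge at the kernel is in all maximum matchings. -/
theorem SatMatch.exists_ne_of_mem_nbhd_ker (hf : SatMatch G S f) (hS : IsMaxIndep G S)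
    (hG : IsKE G) {x : V} (hx : x ∈ nbhd G (ker G)) :
    ∃ g, SatMatch G S g ∧ g x ≠ f x := by
  by_contra! hcon
  have hK := isCriticalIndep_ker (hf.isCriticalIndep hS.1)
  have hKS : ker G ⊆ S := hG.ker_subset_core.trans (core_subset hS)
  have hsub : nbhd G (ker G) ⊆ Sᶜ := fun x hx =>
    not_mem_of_mem_nbhd_core hS (nbhd_mono hG.ker_subset_core hx)
  obtain ⟨X, hXS, hxX, hX, -⟩ := hf.exists_tight (hsub hx) hcon
  have hker := hf.ker_eq hS hG
  -- Removing `f '' X` costs the kernel at most `|N(ker G) ∩ X|` vertices, while by tightness its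
  -- neighborhood loses all of `N(ker G) ∩ X`. The difference does not drop, so the remainder is
  -- critical, yet it misses `f x`.
  have h1 : ker G ∩ f '' X ⊆ f '' (nbhd G (ker G) ∩ X) := by
    rintro _ ⟨hv, y, hy, rfl⟩
    exact ⟨y, ⟨hf.mem_nbhd_of_map_mem (hXS hy) hv, hy⟩, rfl⟩
  have h2 : nbhd G (ker G \ f '' X) ⊆ nbhd G (ker G) \ X := by
    intro v hv
    obtain ⟨c, hc, hvc⟩ := mem_nbhd.1 hv
    exact ⟨mem_nbhd.2 ⟨c, hc.1, hvc⟩, fun h => hc.2 (hX v h c (hKS hc.1) hvc)⟩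
  have h3 := (Set.ncard_le_ncard h1).trans (Set.ncard_image_le (Set.toFinite _))
  have h4 := Set.ncard_le_ncard h2
  have h5 := Set.ncard_inter_add_ncard_sdiff_eq_ncard (ker G) (f '' X)
  have h6 := Set.ncard_inter_add_ncard_sdiff_eq_ncard (nbhd G (ker G)) X
  have hcrit : IsCriticalIndep G (ker G \ f '' X) := by
    refine ⟨hK.1.mono Set.sdiff_subset, le_antisymm ((isGreatest_critDiff G).2 ⟨_, rfl⟩) ?_⟩
    rw [← hK.2]
    unfold diff
    omega
  have hfx : f x ∈ ker G := by
    rw [hker]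
    exact Or.inr ⟨x, hx, rfl⟩
  exact (ker_subset hcrit hfx).2 ⟨x, hxX, rfl⟩

end Core

/-! ### Edges whose deletion leaves a König–Egerváry graph -/

section Deletion

variable {G : SimpleGraph V} {S : Set V} {f : V → V}

theorem SatMatch.map_not_mem_compl (hf : SatMatch G S f) : ∀ x ∈ Sᶜ, f x ∉ Sᶜ :=
  fun x hx h => h (hf.mapsTo x hx)

theorem eq_of_mk_eq {x y z : V} (hy : y ∈ S)
    (h : s(z, f z) = s(x, y)) (hz : z ∉ S) : z = x ∧ f x = y := by
  rcases Sym2.eq_iff.1 h with h' | ⟨rfl, -⟩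
  · exact ⟨h'.1, h'.1 ▸ h'.2⟩
  · exact absurd hy hz

theorem IsPerfectMatchingBetween.mem_of_adj {A B : Set V} {M : G.Subgraph}
    (hM : IsPerfectMatchingBetween G A B M) (hAB : Disjoint A B) {x y : V} (hx : x ∈ B)
    (hxy : M.Adj x y) : y ∈ A := by
  obtain ⟨-, a, ha, b, hb, hab⟩ := hM.2.1 (SimpleGraph.Subgraph.mem_edgeSet.2 hxy)
  rcases Sym2.eq_iff.1 hab with ⟨rfl, rfl⟩ | ⟨rfl, rfl⟩
  · exact absurd hx (Set.disjoint_left.1 hAB ha)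
  · exact ha

variable [Fintype V]

theorem SatMatch.isKE_deleteEdges (hf : SatMatch G S f) (hS : G.IsIndepSet S) {e : Sym2 V}
    (he : ∀ x ∉ S, s(x, f x) ≠ e) : IsKE (G.deleteEdges {e}) := by
  refine SatMatch.isKE (S := S) (f := f) ⟨hf.mapsTo, fun x hx => ?_, hf.inj⟩
    (isIndepSet_of fun a ha b hb h => not_adj_of_mem hS ha hb (SimpleGraph.deleteEdges_le _ h))
  rw [SimpleGraph.deleteEdges_adj]
  exact ⟨hf.adj x hx, he x hx⟩

/-- An edge of all maximum matchings that has no endpoint in the core is `α`-critical. -/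
theorem SatMatch.isKE_deleteEdges_of_not_mem (hf : SatMatch G S f) (hS : IsMaxIndep G S) {x : V}
    (hx : x ∉ S) (hxN : x ∉ nbhd G (core G)) : IsKE (G.deleteEdges {s(x, f x)}) := by
  by_cases hall : ∀ g, SatMatch G S g → g x = f x
  swap
  · push Not at hall
    obtain ⟨g, hg, hgx⟩ := hall
    exact hg.isKE_deleteEdges hS.1 fun z hz h => hgx (eq_of_mk_eq (hf.mapsTo x hx) h hz).2
  obtain ⟨X, hXS, hxX, hX, hXx⟩ := hf.exists_tight hx hall
  have hfx : f x ∉ core G := fun h => hxN (hf.mem_nbhd_of_map_mem hx h)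
  rw [mem_core] at hfx
  push Not at hfx
  obtain ⟨S', hS', hfxS'⟩ := hfx
  have hmem : ∀ y ∉ S, f y ∉ S' → y ∈ S' := by
    intro y hy hfy
    obtain ⟨z, hz, hzy, hzS'⟩ := hf.exists_of_not_mem hS hS' (hf.mapsTo y hy) hfy
    rwa [hf.inj z hz y hy hzy] at hzS'
  have hxS' := hmem x hx hfxS'
  -- By tightness `a = f y` with `y ∈ X`. If `y ∉ S'` then `f y ∈ S'`, against independence of `S'`;
  -- so `y ∈ S'`, which leaves only `y = x`.
  have hcross : ∀ a ∈ S \ f '' ((X ∩ S') \ {x}), ∀ b ∈ X ∩ S',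
      G.Adj b a → a = f x ∧ b = x := by
    rintro a ⟨haS, ha⟩ b ⟨hbX, hbS'⟩ hba
    obtain ⟨y, hy, rfl⟩ := hX b hbX a haS hba
    by_cases hyS' : y ∈ S'
    · have hyx : y = x := by
        by_contra hne
        exact ha ⟨y, ⟨⟨hy, hyS'⟩, hne⟩, rfl⟩
      subst hyx
      exact ⟨rfl, hXx b hbX hba⟩
    · by_contra
      exact not_adj_of_mem hS'.1 hbS' (by_contra fun h => hyS' (hmem y (hXS hy) h)) hba
  -- In `S`, each `f y` with `y ∈ X ∩ S'` is exchanged for `y`, except that `x` is added while `f x`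
  -- stays: one vertex more than `S`, which offsets the lost matching edge.
  have hind : (G.deleteEdges {s(x, f x)}).IsIndepSet
      ((S \ f '' ((X ∩ S') \ {x})) ∪ (X ∩ S')) := by
    refine isIndepSet_of ?_
    intro a ha b hb hab
    rw [SimpleGraph.deleteEdges_adj] at hab
    obtain ⟨hab, hne⟩ := hab
    rcases ha with ha | ha <;> rcases hb with hb | hb
    · exact not_adj_of_mem hS.1 ha.1 hb.1 hab
    · obtain ⟨rfl, rfl⟩ := hcross a ha b hb hab.symm
      exact hne Sym2.eq_swap
    · obtain ⟨rfl, rfl⟩ := hcross b hb a ha hab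
      exact hne rfl
    · exact not_adj_of_mem hS'.1 ha.2 hb.2 hab
  have hsub : ∀ y ∈ Sᶜ \ {x}, y ∉ S := fun y hy => hy.1
  refine isKE_of (X := Sᶜ \ {x}) (f := f) hind ?_ ?_ ?_ ?_
  · intro y hy
    rw [SimpleGraph.deleteEdges_adj]
    exact ⟨hf.adj y hy.1, fun h => hy.2 (eq_of_mk_eq (hf.mapsTo x hx) h hy.1).1⟩
  · exact fun y hy h => h.1 (hf.mapsTo y hy.1)
  · exact fun y hy z hz => hf.inj y hy.1 z hz.1
  · have h1 : (f '' ((X ∩ S') \ {x})).ncard = ((X ∩ S') \ {x}).ncard :=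
      Set.InjOn.ncard_image fun y hy z hz => hf.inj y (hXS hy.1.1) z (hXS hz.1.1)
    have h2 : f '' ((X ∩ S') \ {x}) ⊆ S := by
      rintro _ ⟨y, hy, rfl⟩
      exact hf.mapsTo y (hXS hy.1.1)
    have h3 := Set.ncard_sdiff_add_ncard_of_subset h2
    have h4 : Disjoint (S \ f '' ((X ∩ S') \ {x})) (X ∩ S') :=
      Set.disjoint_left.2 fun y hy hy' => hXS hy'.1 hy.1
    have h5 := Set.ncard_union_eq h4
    have h6 := Set.ncard_sdiff_singleton_add_one (s := X ∩ S') ⟨hxX, hxS'⟩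
    have h7 := Set.ncard_sdiff_singleton_add_one (s := Sᶜ) hx
    have h8 := Set.ncard_add_ncard_compl S
    omega

/-- An edge of all maximum matchings with an endpoint in the neighborhood of the core is not
`α`-critical. -/
theorem SatMatch.not_isKE_deleteEdges (hf : SatMatch G S f) (hS : IsMaxIndep G S) {x : V}
    (hxN : x ∈ nbhd G (core G)) (hall : ∀ g, SatMatch G S g → g x = f x) :
    ¬ IsKE (G.deleteEdges {s(x, f x)}) := by
  intro hKE
  have hx := not_mem_of_mem_nbhd_core hS hxN
  have hle := SimpleGraph.deleteEdges_le (G := G) {s(x, f x)}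
  have hSI : (G.deleteEdges {s(x, f x)}).IsIndepSet S :=
    isIndepSet_of fun a ha b hb h => not_adj_of_mem hS.1 ha hb (hle h)
  -- If the independence number has not grown, `S` is still maximum and a matching survives without
  -- the forced edge. Otherwise a larger set `T` contains both endpoints, and `T \ {f x}` is a
  -- maximum independent set of `G` containing a neighbor of the core.
  by_cases hα : (G.deleteEdges {s(x, f x)}).indepNum ≤ S.ncard
  · obtain ⟨g, hg⟩ := hKE.exists_satMatch (isMaxIndep_of_le hSI hα)
    have hgG : SatMatch G S g := ⟨hg.mapsTo, fun y hy => hle (hg.adj y hy), hg.inj⟩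
    have := hg.adj x hx
    rw [SimpleGraph.deleteEdges_adj, hall g hgG] at this
    exact this.2 rfl
  · obtain ⟨T, hT⟩ := exists_isMaxIndep (G.deleteEdges {s(x, f x)})
    have hTc : S.ncard < T.ncard := by rw [hT.2]; omega
    have hTadj : ∀ a ∈ T, ∀ b ∈ T, G.Adj a b → s(a, b) = s(x, f x) := by
      intro a ha b hb hab
      by_contra hne
      exact not_adj_of_mem hT.1 ha hb (SimpleGraph.deleteEdges_adj.2 ⟨hab, hne⟩)
    have hdel : ∀ v, v ∈ s(x, f x) → IsMaxIndep G (T \ {v}) := by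
      intro v hv
      refine isMaxIndep_of_le (isIndepSet_of fun a ha b hb hab => ?_) ?_
      · rw [← hTadj a ha.1 b hb.1 hab, Sym2.mem_iff] at hv
        rcases hv with rfl | rfl
        · exact ha.2 rfl
        · exact hb.2 rfl
      · have := Set.ncard_le_ncard_sdiff_add_ncard T {v}
        rw [Set.ncard_singleton] at this
        rw [← hS.2]
        omega
    have hxT : x ∈ T := by
      by_contra hxT
      have hI : G.IsIndepSet T := by
        have := (hdel x (Sym2.mem_mk_left _ _)).1
        rwa [Set.sdiff_singleton_eq_self hxT] at this
      have := ncard_le_indepNum hI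
      have := hS.2
      omega
    exact not_mem_of_mem_nbhd_core (hdel (f x) (Sym2.mem_mk_right _ _)) hxN
      ⟨hxT, fun h => (hf.adj x hx).ne h⟩

theorem SatMatch.setOf_not_isKE (hf : SatMatch G S f) (hS : IsMaxIndep G S) (hG : IsKE G) :
    {e | e ∈ G.edgeSet ∧ ¬ IsKE (G.deleteEdges {e})} = (fun x => s(x, f x)) ''
      {x | x ∈ nbhd G (core G) \ nbhd G (ker G) ∧ ∀ g, SatMatch G S g → g x = f x} := by
  ext e
  constructor
  · rintro ⟨he, hKE⟩
    have hex : ∃ x ∉ S, s(x, f x) = e := by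
      by_contra! h
      exact hKE (hf.isKE_deleteEdges hS.1 h)
    obtain ⟨x, hx, rfl⟩ := hex
    have hall : ∀ g, SatMatch G S g → g x = f x := by
      intro g hg
      by_contra hgx
      exact hKE (hg.isKE_deleteEdges hS.1 fun z hz h =>
        hgx (eq_of_mk_eq (hf.mapsTo x hx) h hz).2)
    refine ⟨x, ⟨⟨by_contra fun h => hKE (hf.isKE_deleteEdges_of_not_mem hS hx h), ?_⟩, hall⟩, rfl⟩
    intro hxK
    obtain ⟨g, hg, hgx⟩ := hf.exists_ne_of_mem_nbhd_ker hS hG hxK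
    exact hgx (hall g hg)
  · rintro ⟨x, ⟨hx, hall⟩, rfl⟩
    exact ⟨hf.adj x (not_mem_of_mem_nbhd_core hS hx.1), hf.not_isKE_deleteEdges hS hx.1 hall⟩

theorem rhoE_add (G : SimpleGraph V) :
    rhoE G + {e | e ∈ G.edgeSet ∧ ¬ IsKE (G.deleteEdges {e})}.ncard = G.edgeSet.ncard := by
  exact Set.ncard_inter_add_ncard_sdiff_eq_ncard G.edgeSet {e | IsKE (G.deleteEdges {e})}

theorem SatMatch.rhoE_eq_iff (hf : SatMatch G S f) (hS : IsMaxIndep G S) (hG : IsKE G) :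
    (rhoE G : ℤ) = (G.edgeSet.ncard : ℤ) - (xi G : ℤ) + (eps G : ℤ) ↔
      ∀ x ∈ nbhd G (core G) \ nbhd G (ker G), ∀ g, SatMatch G S g → g x = f x := by
  have h1 := rhoE_add G
  rw [hf.setOf_not_isKE hS hG] at h1
  obtain ⟨h2, h3⟩ := hf.ncard_nbhd_diff hS hG
  set Q := nbhd G (core G) \ nbhd G (ker G) with hQ
  have hsub : {x | x ∈ Q ∧ ∀ g, SatMatch G S g → g x = f x} ⊆ Q := fun x hx => hx.1
  have h4 := ((mk_injOn hf.map_not_mem_compl).mono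
    (hsub.trans fun x hx => not_mem_of_mem_nbhd_core hS hx.1)).ncard_image
  constructor
  · intro h
    have heq := Set.eq_of_subset_of_ncard_le hsub (by omega)
    intro x hx
    rw [← heq] at hx
    exact hx.2
  · intro h
    have heq : {x | x ∈ Q ∧ ∀ g, SatMatch G S g → g x = f x} = Q :=
      hsub.antisymm fun x hx => ⟨hx, h x hx⟩
    rw [heq] at h1 h4
    omega

/-! ### Perfect matchings between the differences -/

theorem SatMatch.isPerfectMatchingBetween (hf : SatMatch G S f) (hS : IsMaxIndep G S)
    (hG : IsKE G) (h : ∀ x ∈ nbhd G (core G) \ nbhd G (ker G), G.Adj x (f x)) :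
    IsPerfectMatchingBetween G (core G \ ker G) (nbhd G (core G) \ nbhd G (ker G))
      (pairing G (nbhd G (core G) \ nbhd G (ker G)) f h) := by
  have hsub : ∀ x ∈ nbhd G (core G) \ nbhd G (ker G), x ∉ S :=
    fun x hx => not_mem_of_mem_nbhd_core hS hx.1
  have him := hf.image_eq hS hG
  refine ⟨pairing_isMatching h (fun x hx h => hsub _ h (hf.mapsTo x (hsub x hx)))
    (fun x hx y hy => hf.inj x (hsub x hx) y (hsub y hy)), ?_, ?_⟩
  · rw [pairing_edgeSet]
    rintro _ ⟨x, hx, rfl⟩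
    exact ⟨h x hx, f x, him ▸ ⟨x, hx, rfl⟩, x, hx, Sym2.eq_swap⟩
  · rw [← him, Set.union_comm]
    rfl

theorem SatMatch.existsUnique_iff (hf : SatMatch G S f) (hS : IsMaxIndep G S) (hG : IsKE G) :
    (∃! M : G.Subgraph, IsPerfectMatchingBetween G (core G \ ker G)
      (nbhd G (core G) \ nbhd G (ker G)) M) ↔
      ∀ x ∈ nbhd G (core G) \ nbhd G (ker G), ∀ g, SatMatch G S g → g x = f x := by
  classical
  have hsub : ∀ x ∈ nbhd G (core G) \ nbhd G (ker G), x ∉ S :=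
    fun x hx => not_mem_of_mem_nbhd_core hS hx.1
  have hadj : ∀ g, SatMatch G S g → ∀ x ∈ nbhd G (core G) \ nbhd G (ker G), G.Adj x (g x) :=
    fun g hg x hx => hg.adj x (hsub x hx)
  have hAS : core G \ ker G ⊆ S := Set.sdiff_subset.trans (core_subset hS)
  have hdisj : Disjoint (core G \ ker G) (nbhd G (core G) \ nbhd G (ker G)) :=
    Set.disjoint_left.2 fun x hx hx' => hsub x hx' (hAS hx)
  have him := hf.image_eq hS hG
  have hPM := fun g (hg : SatMatch G S g) => hg.isPerfectMatchingBetween hS hG (hadj g hg)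
  constructor
  · rintro ⟨M, -, hM⟩ x hx g hg
    have heq := (hM _ (hPM g hg)).trans (hM _ (hPM f hf)).symm
    have h1 : (pairing G _ g (hadj g hg)).Adj x (g x) := Or.inl ⟨hx, rfl⟩
    rw [heq] at h1
    rcases h1 with h | h
    · exact h.2
    · exact absurd (hg.mapsTo x (hsub x hx)) (hsub _ h.1)
  · intro hall
    refine ⟨_, hPM f hf, fun M hM => ?_⟩
    set Q := nbhd G (core G) \ nbhd G (ker G) with hQ
    have hex : ∀ x, ∃ y, x ∈ Q → M.Adj x y := by
      intro x
      by_cases hx : x ∈ Q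
      · obtain ⟨y, hy, -⟩ := hM.1 (hM.2.2 ▸ Or.inr hx : x ∈ M.verts)
        exact ⟨y, fun _ => hy⟩
      · exact ⟨x, fun h => absurd h hx⟩
    choose p hp using hex
    have hpA : ∀ x ∈ Q, p x ∈ core G \ ker G := fun x hx => hM.mem_of_adj hdisj hx (hp x hx)
    -- This makes the splice below injective: outside `Q`, the partners under `f` avoid `core G \
    -- ker G`, where all values of `p` on `Q` lie.
    have hfA : ∀ x ∉ S, x ∉ Q → f x ∉ core G \ ker G := by
      intro x hx hxQ h
      rw [← him] at h
      obtain ⟨y, hy, hyx⟩ := h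
      exact hxQ (hf.inj y (hsub y hy) x hx hyx ▸ hy)
    have hg : SatMatch G S (fun x => if x ∈ Q then p x else f x) := by
      refine ⟨fun x hx => ?_, fun x hx => ?_, fun x hx y hy hxy => ?_⟩
      · split_ifs with h
        · exact hAS (hpA x h)
        · exact hf.mapsTo x hx
      · split_ifs with h
        · exact (hp x h).adj_sub
        · exact hf.adj x hx
      · split_ifs at hxy with h1 h2 h2
        · exact hM.1.eq_of_adj_right (hp x h1) (hxy ▸ hp y h2)
        · exact absurd (hxy ▸ hpA x h1) (hfA y hy h2)
        · exact absurd (hxy ▸ hpA y h2) (hfA x hx h1)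
        · exact hf.inj x hx y hy hxy
    have hMf : ∀ x ∈ Q, M.Adj x (f x) := by
      intro x hx
      have := hall x hx _ hg
      simp only [if_pos hx] at this
      exact this ▸ hp x hx
    refine SimpleGraph.Subgraph.ext (hM.2.2.trans (hPM f hf).2.2.symm) ?_
    ext u v
    constructor
    · intro huv
      obtain ⟨-, a, ha, b, hb, hab⟩ := hM.2.1 (SimpleGraph.Subgraph.mem_edgeSet.2 huv)
      rcases Sym2.eq_iff.1 hab with ⟨rfl, rfl⟩ | ⟨rfl, rfl⟩
      · exact Or.inr ⟨hb, hM.1.eq_of_adj_left huv.symm (hMf _ hb)⟩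
      · exact Or.inl ⟨hb, hM.1.eq_of_adj_left huv (hMf _ hb)⟩
    · rintro (⟨hu, rfl⟩ | ⟨hv, rfl⟩)
      · exact hMf u hu
      · exact (hMf v hv).symm

end Deletion

end KonigEgervary

theorem mainTheorem7 {V : Type*} [Fintype V] (G : SimpleGraph V)
    (hG : KonigEgervary.IsKE G) :
    (KonigEgervary.rhoE G : ℤ) =
        (G.edgeSet.ncard : ℤ) - (KonigEgervary.xi G : ℤ) + (KonigEgervary.eps G : ℤ) ↔
      ∃! M : G.Subgraph,
        KonigEgervary.IsPerfectMatchingBetween G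
          (KonigEgervary.core G \ KonigEgervary.ker G)
          (KonigEgervary.nbhd G (KonigEgervary.core G) \
            KonigEgervary.nbhd G (KonigEgervary.ker G)) M := by
  obtain ⟨S, hS⟩ := KonigEgervary.exists_isMaxIndep G
  obtain ⟨f, hf⟩ := hG.exists_satMatch hS
  exact (hf.rhoE_eq_iff hS hG).trans (hf.existsUnique_iff hS hG).symm
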